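/- Let $k\ge 2$ and $N\ge 1$ be integers, $\chi$ a Dirichlet character modulo $N$, and $f(z)=\sum_{n\ge1}\lambda_f(n)e^{2\pi i n z}$ a primitive form in $S_k(N,\chi)$, i.e. a holomorphic cusp form of weight $k$ for $\Gamma_0(N)$ with nebentypus $\chi$ that is an eigenfunction of all Hecke operators $T_n$ $(n\ge 1)$ and is normalized by $\lambda_f(1)=1$ (every newform of level $N$ is such a form). Assume that $f$ is not of CM type, i.e. that there is no nontrivial Dirichlet character $\eta$, of some modulus $M\ge1$, with $\eta(p)\lambda_f(p)=\lambda_f(p)$ for all primes $p\nmid MN$. Let $$\mathcal P_f^*=\{p \text{ prime}: p\mid N\}\cup\{p \text{ prime}: p\nmid N \text{ and } \lambda_f(p^\nu)=0 \text{ for some } \nu\ge 1\},$$ and assume that $$\bigl|\mathcal P_f^*\cap[1,x]\bigr|\ll_f x^{\rho}\,\frac{(\log\log x)^{\Psi}}{(\log x)^{\Theta}}\qquad(x\ge 3),$$ where $\rho\in[0,1]$ and $\Theta,\Psi$ are real constants, with $\Theta>1$ if $\rho=1$. Then for every $\varepsilon>0$ there are constants $x_0$, $c>0$ and $C$, depending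 only on $f$ and $\varepsilon$, such that: (i) for all real $x\ge x_0$ and $y\ge x^{\rho/(1+\rho)+\varepsilon}$, $$\bigl|\{n\in\mathbb N : x<n\le x+y \text{ and } \lambda_f(n)\ne 0\}\bigr|\ \ge\ c\,y;$$ (ii) for every integer $n\ge1$, the quantity $i_f(n)=\max\{m\ge 1:\lambda_f(n+j)=0 \text{ for } 0<j\le m\}$ (with $i_f(n)=0$ if there is no such $m$) is finite and satisfies $$i_f(n)\le C\,n^{\rho/(1+\rho)+\varepsilon}.$$ -/

import Mathlib

open scoped MatrixGroups

noncomputable section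

namespace KRW

/-- Cusp forms of weight `k` for `Γ₁(N)`. -/
abbrev CuspFormGamma1 (N : ℕ) (k : ℤ) : Type :=
  CuspForm (CongruenceSubgroup.Gamma1 N : Subgroup (GL (Fin 2) ℝ)) k

/-- The `n`-th Fourier coefficient at infinity, `f(z) = ∑ λ_f(n) e(nz)` with `e(z) = exp(2πiz)`. -/
def coeff {N : ℕ} {k : ℤ} (f : CuspFormGamma1 N k) (n : ℕ) : ℂ :=
  (UpperHalfPlane.qExpansion 1 f).coeff n

/-- `f` lies in `S_k(N, χ)`: it is a cusp form of weight `k` for `Γ₀(N)` with nebentypus `χ`, i.e.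
`f((az + b)/(cz + d)) = χ(d) (cz + d)^k f(z)` for every matrix in `Γ₀(N)`. (Holomorphy and vanishing
at all the cusps, which are the same for `Γ₁(N)` and `Γ₀(N)`, are part of the type of `f`.) -/
def HasNebentypus {N : ℕ} {k : ℤ} (χ : DirichletCharacter ℂ N) (f : CuspFormGamma1 N k) : Prop :=
  ∀ γ : SL(2, ℤ), γ ∈ CongruenceSubgroup.Gamma0 N → ∀ z : UpperHalfPlane,
    f (γ • z) = χ ((γ 1 1 : ℤ) : ZMod N) *
      (((γ 1 0 : ℤ) : ℂ) * (z : ℂ) + ((γ 1 1 : ℤ) : ℂ)) ^ k * f z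

/-- The Hecke operator `T_n` (`n ≥ 1`) of weight `k` and nebentypus `χ`:
`(T_n f)(z) = (1/n) ∑_{ad = n} χ(a) a^k ∑_{0 ≤ b < d} f((az + b)/d)`.
For `n ≥ 1` all the points `(az + b)/d` lie in the upper half plane, so that `ofComplex` merely
regards them as points of it. -/
def heckeT {N : ℕ} (k : ℤ) (χ : DirichletCharacter ℂ N) (n : ℕ) (f : UpperHalfPlane → ℂ) :
    UpperHalfPlane → ℂ := fun z =>
  (n : ℂ)⁻¹ * ∑ ad ∈ n.divisorsAntidiagonal, χ (ad.1 : ZMod N) * (ad.1 : ℂ) ^ k *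
    ∑ b ∈ Finset.range ad.2,
      f (UpperHalfPlane.ofComplex (((ad.1 : ℂ) * (z : ℂ) + (b : ℂ)) / (ad.2 : ℂ)))

/-- The set `S_k^*(N, χ)`: elements of `S_k(N, χ)` that are eigenfunctions of all the Hecke
operators `T_n`, `n ≥ 1` (including those with `n` not prime to `N`), normalized by `λ_f(1) = 1`.
Every newform of level `N` and nebentypus `χ` belongs to it. -/
structure IsPrimitive {N : ℕ} {k : ℤ} (χ : DirichletCharacter ℂ N)
    (f : CuspFormGamma1 N k) : Prop where
  nebentypus : HasNebentypus χ f
  eigen : ∀ n : ℕ, 1 ≤ n → ∃ μ : ℂ, ∀ z : UpperHalfPlane, heckeT k χ n f z = μ * f z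
  normalized : coeff f 1 = 1

/-- `f` is of CM type: there is a nontrivial Dirichlet character `η` such that
`η(p) λ_f(p) = λ_f(p)` for all primes `p` prime to the modulus of `η` and to the level. -/
def IsCM {N : ℕ} {k : ℤ} (f : CuspFormGamma1 N k) : Prop :=
  ∃ (M : ℕ) (η : DirichletCharacter ℂ M), M ≠ 0 ∧ η ≠ 1 ∧
    ∀ p : ℕ, p.Prime → ¬ p ∣ M → ¬ p ∣ N → η (p : ZMod M) * coeff f p = coeff f p

/-- `𝒫_{f,ν}`: the primes `p` not dividing the level `N` with `λ_f(p^ν) = 0`. -/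
def vanishingPrimes {N : ℕ} {k : ℤ} (f : CuspFormGamma1 N k) (ν : ℕ) : Set ℕ :=
  {p | p.Prime ∧ ¬ p ∣ N ∧ coeff f (p ^ ν) = 0}

/-- `𝒫_f^*`: the primes dividing `N` together with all the `𝒫_{f,ν}`, `ν ≥ 1`. -/
def badPrimes {N : ℕ} {k : ℤ} (f : CuspFormGamma1 N k) : Set ℕ :=
  {p | p.Prime ∧ p ∣ N} ∪ ⋃ ν ≥ 1, vanishingPrimes f ν

/-- The set of all `m ≥ 1` such that `λ_f(n + j) = 0` for `0 < j ≤ m`. -/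
def zeroRuns {N : ℕ} {k : ℤ} (f : CuspFormGamma1 N k) (n : ℕ) : Set ℕ :=
  {m | 1 ≤ m ∧ ∀ j : ℕ, 0 < j → j ≤ m → coeff f (n + j) = 0}

/-- The gap function `i_f(n) = max {m ≥ 1 | λ_f(n + j) = 0 for 0 < j ≤ m}`, equal to `0` when there
is no such `m`. It is meaningful when `zeroRuns f n` is bounded. -/
def gap {N : ℕ} {k : ℤ} (f : CuspFormGamma1 N k) (n : ℕ) : ℕ := sSup (zeroRuns f n)

/-- `|𝒫_f^* ∩ [1, x]| ≪ x^ρ (log log x)^Ψ / (log x)^Θ`, for `x ≥ 3` so that `log log x > 0`. -/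
def BadPrimesBound {N : ℕ} {k : ℤ} (f : CuspFormGamma1 N k) (ρ Θ Ψ : ℝ) : Prop :=
  ∃ A : ℝ, ∀ x : ℝ, 3 ≤ x →
    ({p : ℕ | p ∈ badPrimes f ∧ (p : ℝ) ≤ x}.ncard : ℝ) ≤
      A * (x ^ ρ * Real.log (Real.log x) ^ Ψ / Real.log x ^ Θ)

end KRW

end

/-! ### Multiplicativity of the Fourier coefficients -/

noncomputable section

namespace KRW

open UpperHalfPlane hiding I
open Complex Function.Periodic

/-! Hecke eigenvalues make the coefficients multiplicative on coprime arguments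
(`coeff_mul_of_coprime`), so `coeff f n ≠ 0` as soon as no bad prime divides `n ≥ 1`. What remains
is a statement about a set `B` of primes with convergent reciprocal sum and about X^ρ elements up to
X: short intervals contain a positive proportion of `B`-free integers.

Sieving (x, x + y] directly fails, because primes of `B` as large as x may divide the integers
there. Instead one counts products n = q * l with q a prime in (u, w], where u and w are slightly
larger than x^θ, and l coprime to all elements of `B` up to a constant G (`card_free_ge`). Such n
have boundedly many representations, and they fill a positive proportion of the interval because the
sum of 1/q is bounded below (`exists_sum_inv_primes_ge`). All prime factors of n are at most max(w,
2x/u), so only bad primes in that range and above G must be discarded, each costing y/p + 1. The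
terms y/p form a small tail; the terms 1 number about w + (x/u)^ρ. Balancing gives (1 - θ)ρ = θ,
that is θ = ρ/(1 + ρ).

The gap bound follows by placing such an interval inside a run of zeros. Constants independent of ρ,
Θ, Ψ come from working with one nearly minimal admissible exponent. -/

theorem sum_exp_mul_div (d l : ℕ) (hd : d ≠ 0) :
    ∑ b ∈ Finset.range d, cexp (2 * Real.pi * I * (l * b / d)) = if d ∣ l then (d : ℂ) else 0 := by
  have hd' : (d : ℂ) ≠ 0 := Nat.cast_ne_zero.mpr hd
  set ζ : ℂ := cexp (2 * Real.pi * I * (l / d)) with hζ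
  have hpow : ∀ b : ℕ, cexp (2 * Real.pi * I * (l * b / d)) = ζ ^ b := fun b ↦ by
    rw [hζ, ← Complex.exp_nat_mul]; congr 1; ring
  simp only [hpow]
  split_ifs with h
  · obtain ⟨m, rfl⟩ := h
    have : ζ = 1 := by
      rw [hζ, Complex.exp_eq_one_iff]
      exact ⟨m, by push_cast; field_simp⟩
    simp [this]
  · have hne : ζ ≠ 1 := by
      rw [hζ, Ne, Complex.exp_eq_one_iff]
      rintro ⟨m, hm⟩
      have hpi : (2 * Real.pi * I : ℂ) ≠ 0 := Complex.two_pi_I_ne_zero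
      have h1 : (l : ℂ) / d = m := by
        apply mul_left_cancel₀ hpi; rw [hm]; ring
      rw [div_eq_iff hd'] at h1
      have h2 : (l : ℤ) = m * d := by exact_mod_cast h1
      exact h (by exact_mod_cast (Dvd.intro_left m h2.symm : (d : ℤ) ∣ l))
    have h1 : ζ ^ d = 1 := by
      rw [hζ, ← Complex.exp_nat_mul, Complex.exp_eq_one_iff]
      exact ⟨l, by push_cast; field_simp⟩
    rw [geom_sum_eq hne, h1]; simp

variable {N : ℕ} {k : ℤ}

theorem hasSum_coeff (f : CuspFormGamma1 N k) (τ : ℍ) :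
    HasSum (fun m ↦ coeff f m * cexp (2 * Real.pi * I * (m * (τ : ℂ)))) (f τ) := by
  have h1 : (1 : ℝ) ∈ (CongruenceSubgroup.Gamma1 N : Subgroup (GL (Fin 2) ℝ)).strictPeriods := by
    simp
  have : Fact (IsCusp OnePoint.infty (CongruenceSubgroup.Gamma1 N : Subgroup (GL (Fin 2) ℝ))) :=
    ⟨Subgroup.isCusp_of_mem_strictPeriods one_pos h1⟩
  convert! ModularForm.hasSum_qExpansion f one_pos h1 τ using 2 with m
  rw [coeff, qParam, ← Complex.exp_nat_mul]
  congr 2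
  push_cast
  ring

/-- Uniqueness of the q-expansion, applied to the zero form; level 1 and weight 0 are an arbitrary
choice. -/
theorem eq_zero_of_hasSum_zero {c : ℕ → ℂ}
    (h : ∀ τ : ℍ, HasSum (fun m : ℕ ↦ c m * cexp (2 * Real.pi * I * (m * (τ : ℂ)))) 0) (m : ℕ) :
    c m = 0 := by
  have h1 : (1 : ℝ) ∈ (CongruenceSubgroup.Gamma1 1 : Subgroup (GL (Fin 2) ℝ)).strictPeriods := by
    simp
  have := ModularFormClass.qExpansion_coeff_unique (f := (0 : CuspFormGamma1 1 0)) (c := c) one_pos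
    h1 (fun τ ↦ by
      convert! h τ using 2 with m
      rw [qParam, ← Complex.exp_nat_mul, smul_eq_mul]
      congr 2
      push_cast
      ring) m
  rw [this, FunLike.coe_zero, UpperHalfPlane.qExpansion_zero]; simp

/-- Fourier expansion of one block of the Hecke operator. -/
theorem hasSum_sum_range (f : CuspFormGamma1 N k) {a d : ℕ} (ha : a ≠ 0) (hd : d ≠ 0) (z : ℍ) :
    HasSum (fun m : ℕ ↦ (if a ∣ m then d * coeff f (d * (m / a)) else 0) *
        cexp (2 * Real.pi * I * (m * (z : ℂ))))
      (∑ b ∈ Finset.range d, f (ofComplex (((a : ℂ) * (z : ℂ) + (b : ℂ)) / (d : ℂ)))) := by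
  have hd' : (d : ℂ) ≠ 0 := Nat.cast_ne_zero.mpr hd
  have him (b : ℕ) : 0 < (((a : ℂ) * (z : ℂ) + (b : ℂ)) / (d : ℂ)).im := by
    rw [Complex.div_natCast_im]
    have ha0 : (0 : ℝ) < a := by positivity
    have hd0 : (0 : ℝ) < d := by positivity
    simp only [Complex.add_im, Complex.mul_im, Complex.natCast_re, Complex.natCast_im, zero_mul,
      add_zero]
    exact div_pos (mul_pos ha0 z.im_pos) hd0
  have h1 : HasSum (fun l : ℕ ↦ ∑ b ∈ Finset.range d, coeff f l *
      cexp (2 * Real.pi * I * (l * (((a : ℂ) * (z : ℂ) + (b : ℂ)) / (d : ℂ)))))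
      (∑ b ∈ Finset.range d, f (ofComplex (((a : ℂ) * (z : ℂ) + (b : ℂ)) / (d : ℂ)))) := by
    refine hasSum_sum fun b _ ↦ ?_
    have := hasSum_coeff f (ofComplex (((a : ℂ) * (z : ℂ) + (b : ℂ)) / (d : ℂ)))
    rwa [ofComplex_apply_of_im_pos (him b)] at this ⊢
  have h2 (l : ℕ) : ∑ b ∈ Finset.range d, coeff f l *
      cexp (2 * Real.pi * I * (l * (((a : ℂ) * (z : ℂ) + (b : ℂ)) / (d : ℂ)))) =
      coeff f l * cexp (2 * Real.pi * I * (l * a * z / d)) * (if d ∣ l then (d : ℂ) else 0) := by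
    rw [← sum_exp_mul_div d l hd, Finset.mul_sum]
    refine Finset.sum_congr rfl fun b _ ↦ ?_
    rw [mul_assoc (coeff f l), ← Complex.exp_add]
    congr 2
    field_simp
  simp only [h2] at h1
  -- Only l = d * j survives the sum over b. It contributes at frequency a * j, so both series are
  -- reindexed by j.
  have hinj : Function.Injective (fun j : ℕ ↦ d * j) := fun _ _ h ↦ Nat.eq_of_mul_eq_mul_left (Nat.pos_of_ne_zero hd) h
  rw [← hinj.hasSum_iff (fun l hl ↦ by
    rw [if_neg (fun ⟨j, hj⟩ ↦ hl ⟨j, hj.symm⟩), mul_zero])] at h1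
  have hinj' : Function.Injective (fun j : ℕ ↦ a * j) := fun _ _ h ↦ Nat.eq_of_mul_eq_mul_left (Nat.pos_of_ne_zero ha) h
  rw [← hinj'.hasSum_iff (fun l hl ↦ by
    rw [if_neg (fun ⟨j, hj⟩ ↦ hl ⟨j, hj.symm⟩), zero_mul])]
  refine (congrArg (fun g : ℕ → ℂ ↦ HasSum g _) (funext fun j ↦ ?_)).mpr h1
  simp only [Function.comp, dvd_mul_right, if_true]
  rw [Nat.mul_div_cancel_left _ (Nat.pos_of_ne_zero ha)]
  have harg : (2 * Real.pi * I * (((a * j : ℕ) : ℂ) * z) : ℂ) =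
      2 * Real.pi * I * (((d * j : ℕ) : ℂ) * a * z / d) := by
    push_cast
    field_simp
  rw [harg]
  ring

theorem hasSum_heckeT (χ : DirichletCharacter ℂ N) (f : CuspFormGamma1 N k) (n : ℕ) (z : ℍ) :
    HasSum (fun m : ℕ ↦ ((n : ℂ)⁻¹ * ∑ ad ∈ n.divisorsAntidiagonal,
        χ (ad.1 : ZMod N) * (ad.1 : ℂ) ^ k *
          (if ad.1 ∣ m then ad.2 * coeff f (ad.2 * (m / ad.1)) else 0)) *
        cexp (2 * Real.pi * I * (m * (z : ℂ))))
      (heckeT k χ n f z) := by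
  simp only [mul_assoc, Finset.sum_mul]
  refine HasSum.mul_left _ (hasSum_sum fun ad had ↦ ?_)
  have hne := Nat.ne_zero_of_mem_divisorsAntidiagonal had
  simpa only [mul_assoc] using
    (hasSum_sum_range f hne.1 hne.2 z).mul_left (χ (ad.1 : ZMod N) * (ad.1 : ℂ) ^ k)

/-- For j coprime to n, the j-th coefficient of T_n f sees only the divisor a = 1, so T_n f = μ f
gives λ(jn) = μ λ(j). The normalization, used at j = 1, identifies μ with λ(n). -/
theorem coeff_mul_of_coprime {χ : DirichletCharacter ℂ N} {f : CuspFormGamma1 N k}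
    (hf : IsPrimitive χ f) {m n : ℕ} (hn : 1 ≤ n) (hmn : m.Coprime n) :
    coeff f (m * n) = coeff f m * coeff f n := by
  obtain ⟨μ, hμ⟩ := hf.eigen n hn
  have hn' : (n : ℂ) ≠ 0 := by exact_mod_cast (by omega : n ≠ 0)
  have key (j : ℕ) (hj : j.Coprime n) : coeff f (j * n) = μ * coeff f j := by
    have h := eq_zero_of_hasSum_zero (fun τ ↦ by
      have h1 := (hasSum_heckeT χ f n τ).sub ((hasSum_coeff f τ).mul_left μ)
      rw [hμ τ, sub_self] at h1
      simp only [← mul_assoc (μ)] at h1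
      simp only [← sub_mul] at h1
      exact h1) j
    rw [Finset.sum_eq_single (1, n)] at h
    · simp only [Nat.cast_one, map_one, one_zpow, one_mul, one_dvd, if_true, Nat.div_one] at h
      rw [← mul_assoc, inv_mul_cancel₀ hn', one_mul, sub_eq_zero] at h
      rw [mul_comm, h]
    · rintro ⟨a, d⟩ had hne
      rw [Nat.mem_divisorsAntidiagonal] at had
      have : ¬ a ∣ j := fun haj ↦ by
        have : a = 1 := Nat.eq_one_of_dvd_coprimes hj haj (Dvd.intro _ had.1)
        subst this
        simp at had hne
        exact hne had.1
      simp [this]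
    · intro h1
      exact (h1 (by simp; omega)).elim
  have h1 : coeff f n = μ := by
    have := key 1 (Nat.coprime_one_left n)
    rwa [one_mul, hf.normalized, mul_one] at this
  rw [key m hmn, h1, mul_comm]

theorem coeff_ne_zero_of_forall_badPrimes {χ : DirichletCharacter ℂ N} {f : CuspFormGamma1 N k}
    (hf : IsPrimitive χ f) (n : ℕ) (hn : n ≠ 0) (h : ∀ p ∈ badPrimes f, ¬ p ∣ n) :
    coeff f n ≠ 0 := by
  induction n using Nat.recOnPosPrimePosCoprime with
  | zero => exact (hn rfl).elim
  | one => rw [hf.normalized]; exact one_ne_zero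
  | prime_pow p ν hp hν =>
    have hpn : p ∣ p ^ ν := dvd_pow_self p hν.ne'
    intro h0
    refine h p ?_ hpn
    by_cases hpN : p ∣ N
    · exact Or.inl ⟨hp, hpN⟩
    · exact Or.inr (Set.mem_iUnion₂.mpr ⟨ν, hν, hp, hpN, h0⟩)
  | coprime a b ha hb hab iha ihb =>
    rw [coeff_mul_of_coprime hf (by omega) hab]
    exact mul_ne_zero (iha (by omega) fun p hp hd ↦ h p hp (hd.mul_right b))
      (ihb (by omega) fun p hp hd ↦ h p hp (hd.mul_left a))

end KRW

end

/-! ### Chebyshev-type lower bounds for sums over primes -/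

noncomputable section

namespace KRW

open Filter Asymptotics

/-- Chebyshev's lower bound for ψ passes to θ, since the two differ by O(√t); halving the slope
absorbs the error terms. -/
theorem eventually_mul_le_theta :
    ∀ᶠ t : ℝ in atTop, Real.log 2 / 2 * t ≤ Chebyshev.theta t := by
  have hpsi : (fun t ↦ Chebyshev.psi t - Chebyshev.theta t) =o[atTop] (fun t : ℝ ↦ t) := by
    refine Chebyshev.isBigO_psi_sub_theta_sqrt.trans_isLittleO ?_
    rw [isLittleO_iff_tendsto' (by filter_upwards [eventually_gt_atTop 0] with t ht h; linarith)]
    refine (Real.tendsto_sqrt_atTop.inv_tendsto_atTop).congr' ?_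
    filter_upwards [eventually_gt_atTop 0] with t ht
    rw [Pi.inv_apply, Real.sqrt_div_self']
    simp
  have hlog : (fun t ↦ Real.log (t + 2)) =o[atTop] (fun t : ℝ ↦ t) := by
    have h1 := (Real.isLittleO_log_id_atTop).comp_tendsto
      (tendsto_atTop_add_const_right atTop (2 : ℝ) tendsto_id)
    refine h1.trans_isBigO ?_
    refine IsBigO.of_bound 3 ?_
    filter_upwards [eventually_ge_atTop 1] with t ht
    simp only [Function.comp, id, Real.norm_eq_abs]
    rw [abs_of_pos (by linarith), abs_of_pos (by linarith)]
    linarith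
  have hlog2 : 0.69 < Real.log 2 := by linarith [Real.log_two_gt_d9]
  filter_upwards [hpsi.def (show (0 : ℝ) < 1 / 10 by norm_num),
    hlog.def (show (0 : ℝ) < 1 / 10 by norm_num), eventually_ge_atTop 10] with t h1 h2 h3
  have h4 := Chebyshev.psi_ge' (x := t) (by linarith)
  rw [Real.norm_eq_abs, Real.norm_eq_abs, abs_of_pos (show 0 < t by linarith)] at h1 h2
  have h5 := le_of_abs_le h1
  have h6 := le_of_abs_le h2
  nlinarith [Real.log_two_lt_d9]

/-- The primes in the interval `(s, t]`. -/
def primesIoc (s t : ℝ) : Finset ℕ := (Finset.Ioc ⌊s⌋₊ ⌊t⌋₊).filter Nat.Prime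

theorem mem_primesIoc {s t : ℝ} (hs : 0 ≤ s) (ht : 0 ≤ t) {p : ℕ} :
    p ∈ primesIoc s t ↔ s < p ∧ p ≤ t ∧ p.Prime := by
  rw [primesIoc, Finset.mem_filter, Finset.mem_Ioc, Nat.floor_lt hs, Nat.le_floor_iff ht, and_assoc]

/-- The ratio 8 makes the crude bounds suffice: θ(8t) ≥ 4 log 2 · t, θ(t) ≤ 2 log 2 · t, and the
difference exceeds t. -/
theorem eventually_sum_log_div_ge :
    ∀ᶠ t : ℝ in atTop, 1 / 8 ≤ ∑ p ∈ primesIoc t (8 * t), Real.log p / p := by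
  have h8 : Tendsto (fun t : ℝ ↦ 8 * t) atTop atTop := tendsto_id.const_mul_atTop (by norm_num)
  filter_upwards [h8.eventually eventually_mul_le_theta, eventually_ge_atTop 1] with t h1 ht
  have h2 := Chebyshev.theta_le_log4_mul_x (x := t) (by linarith)
  have hlog4 : Real.log 4 = 2 * Real.log 2 := by
    rw [show (4 : ℝ) = 2 ^ 2 by norm_num, Real.log_pow]; norm_num
  have hlog2 : 0.69 < Real.log 2 := by linarith [Real.log_two_gt_d9]
  have h3 : Chebyshev.theta (8 * t) - Chebyshev.theta t = ∑ p ∈ primesIoc t (8 * t), Real.log p := by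
    rw [Chebyshev.theta, Chebyshev.theta, primesIoc, sub_eq_iff_eq_add', ← Finset.sum_union]
    · refine Finset.sum_congr ?_ fun _ _ ↦ rfl
      rw [← Finset.filter_union, Finset.Ioc_union_Ioc_eq_Ioc (by positivity)
        (Nat.floor_le_floor (by linarith))]
    · refine Finset.disjoint_filter_filter (Finset.disjoint_left.mpr fun p hp hp' ↦ ?_)
      rw [Finset.mem_Ioc] at hp hp'
      omega
  have h4 : t ≤ ∑ p ∈ primesIoc t (8 * t), Real.log p := by
    rw [← h3]; nlinarith
  calc (1 / 8 : ℝ) = (8 * t)⁻¹ * t := by field_simp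
    _ ≤ (8 * t)⁻¹ * ∑ p ∈ primesIoc t (8 * t), Real.log p := by gcongr
    _ ≤ _ := by
      rw [Finset.mul_sum]
      refine Finset.sum_le_sum fun p hp ↦ ?_
      rw [mem_primesIoc (by linarith) (by linarith)] at hp
      have hp0 : (0 : ℝ) < p := by linarith
      rw [mul_comm, div_eq_mul_inv]
      gcongr
      exact hp.2.1

theorem exists_sum_log_div_ge :
    ∃ t₀ : ℝ, 1 ≤ t₀ ∧ ∀ t, t₀ ≤ t → ∀ J : ℕ,
      (J : ℝ) / 8 ≤ ∑ p ∈ primesIoc t (8 ^ J * t), Real.log p / p := by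
  obtain ⟨t₀, h⟩ := (eventually_sum_log_div_ge.and (eventually_ge_atTop 1)).exists_forall_of_atTop
  refine ⟨t₀, (h t₀ le_rfl).2, fun t ht J ↦ ?_⟩
  have ht1 := (h t ht).2
  induction J with
  | zero =>
    simp only [Nat.cast_zero, zero_div]
    exact Finset.sum_nonneg fun p _ ↦ div_nonneg (Real.log_natCast_nonneg p) p.cast_nonneg
  | succ J ih =>
    have h8 : (1 : ℝ) ≤ 8 ^ J := one_le_pow₀ (by norm_num)
    have h1 := (h (8 ^ J * t) (by nlinarith)).1
    have h2 : primesIoc t (8 ^ (J + 1) * t) =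
        primesIoc t (8 ^ J * t) ∪ primesIoc (8 ^ J * t) (8 * (8 ^ J * t)) := by
      rw [primesIoc, primesIoc, primesIoc, ← Finset.filter_union, Finset.Ioc_union_Ioc_eq_Ioc
        (Nat.floor_le_floor (by nlinarith)) (Nat.floor_le_floor (by nlinarith))]
      congr 3
      ring
    rw [h2, Finset.sum_union]
    · push_cast; linarith
    · refine Finset.disjoint_filter_filter (Finset.disjoint_left.mpr fun p hp hp' ↦ ?_)
      rw [Finset.mem_Ioc] at hp hp'
      omega

/-- A weak form of Mertens' theorem: the primes in `(x ^ a, x ^ b]` have a reciprocal sum bounded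
below. -/
theorem exists_sum_inv_primes_ge {a b : ℝ} (ha : 0 < a) (hab : a < b) :
    ∃ c > 0, ∀ᶠ x : ℝ in atTop, c ≤ ∑ p ∈ primesIoc (x ^ a) (x ^ b), (p : ℝ)⁻¹ := by
  obtain ⟨t₀, ht₀, h⟩ := exists_sum_log_div_ge
  have hb : 0 < b := ha.trans hab
  have hl8 : 0 < Real.log 8 := Real.log_pos (by norm_num)
  refine ⟨(b - a) / (16 * Real.log 8 * b), div_pos (by linarith) (by positivity), ?_⟩
  filter_upwards [(tendsto_rpow_atTop ha).eventually (eventually_ge_atTop t₀),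
    Real.tendsto_log_atTop.eventually (eventually_ge_atTop (2 * Real.log 8 / (b - a))),
    eventually_gt_atTop 1] with x hx hlogx hx1
  have hlog : 0 < Real.log x := Real.log_pos hx1
  -- The number of factors 8 between x^a and x^b. It is proportional to log x, which compensates the
  -- loss log p ≤ b log x on passing from log p / p to 1 / p.
  set r : ℝ := (b - a) * Real.log x / Real.log 8 with hr
  have hr2 : 2 ≤ r := by
    rw [hr, le_div_iff₀ hl8]
    rw [div_le_iff₀ (by linarith)] at hlogx
    linarith
  set J : ℕ := ⌊r⌋₊
  have hJ : r / 2 ≤ J := by have := Nat.sub_one_lt_floor r; linarith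
  have hJ' : (J : ℝ) ≤ r := Nat.floor_le (by linarith)
  have h8J : (8 : ℝ) ^ J * x ^ a ≤ x ^ b := by
    have : (8 : ℝ) ^ J ≤ x ^ (b - a) := by
      rw [← Real.rpow_natCast, Real.rpow_def_of_pos (by norm_num), Real.rpow_def_of_pos (by linarith)]
      refine Real.exp_le_exp.mpr ?_
      calc Real.log 8 * J ≤ Real.log 8 * r := by gcongr
        _ = Real.log x * (b - a) := by rw [hr]; field_simp
    calc (8 : ℝ) ^ J * x ^ a ≤ x ^ (b - a) * x ^ a := by gcongr
      _ = x ^ b := by rw [← Real.rpow_add (by linarith)]; congr 1; ring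
  have hsub : primesIoc (x ^ a) (8 ^ J * x ^ a) ⊆ primesIoc (x ^ a) (x ^ b) :=
    Finset.filter_subset_filter _ (Finset.Ioc_subset_Ioc_right (Nat.floor_le_floor h8J))
  have hbl : 0 < b * Real.log x := by positivity
  have key : (J : ℝ) / 8 ≤ (b * Real.log x) * ∑ p ∈ primesIoc (x ^ a) (x ^ b), (p : ℝ)⁻¹ := by
    refine (h _ hx J).trans ((Finset.sum_le_sum_of_subset_of_nonneg hsub fun p _ _ ↦ ?_).trans ?_)
    · have := Real.log_natCast_nonneg p; positivity
    · rw [Finset.mul_sum]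
      refine Finset.sum_le_sum fun p hp ↦ ?_
      rw [mem_primesIoc (by positivity) (by positivity)] at hp
      rw [div_eq_mul_inv]
      gcongr
      rw [← Real.log_rpow (by linarith)]
      exact Real.log_le_log (by exact_mod_cast hp.2.2.pos) hp.2.1
  calc (b - a) / (16 * Real.log 8 * b) = (r / 2 / 8) / (b * Real.log x) := by
        rw [hr]; field_simp; ring
    _ ≤ (J / 8) / (b * Real.log x) := by gcongr
    _ ≤ _ := by rwa [div_le_iff₀' hbl]

end KRW

end

/-! ### Elementary sieve and counting lemmas -/

noncomputable section

namespace KRW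

open Filter

theorem card_filter_coprime_Ico_add_mul (P m K : ℕ) :
    ((Finset.Ico m (m + K * P)).filter P.Coprime).card = K * P.totient := by
  induction K with
  | zero => simp
  | succ K ih =>
    rw [show m + (K + 1) * P = m + K * P + P by ring,
      ← Finset.Ico_union_Ico_eq_Ico (b := m + K * P) (by omega) (by omega), Finset.filter_union,
      Finset.card_union_of_disjoint, ih, Nat.filter_coprime_Ico_eq_totient]
    · ring
    · exact Finset.disjoint_filter_filter (Finset.Ico_disjoint_Ico_consecutive _ _ _)

/-- Integers coprime to `P` in a real interval `(a, a + H]`. -/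
theorem le_card_coprime_Ioc {P : ℕ} (hP : P ≠ 0) {a H : ℝ} (ha : 0 ≤ a) (hH : 0 ≤ H) :
    (P.totient : ℝ) / P * H - 2 * P ≤
      ((Finset.Ioc ⌊a⌋₊ ⌊a + H⌋₊).filter P.Coprime).card := by
  have hP1 : (1 : ℝ) ≤ P := by exact_mod_cast Nat.one_le_iff_ne_zero.mpr hP
  set s := ⌊a⌋₊
  set t := ⌊a + H⌋₊
  have hst : s ≤ t := Nat.floor_le_floor (by linarith)
  -- The number of full periods modulo P; the ends lose at most 1 + P ≤ 2P integers.
  set K := (t - s) / P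
  have hsub : (Finset.Ico (s + 1) (s + 1 + K * P)).filter P.Coprime ⊆
      (Finset.Ioc s t).filter P.Coprime := by
    refine Finset.filter_subset_filter _ fun n hn ↦ ?_
    have : K * P ≤ t - s := Nat.div_mul_le_self (t - s) P
    rw [Finset.mem_Ico] at hn
    rw [Finset.mem_Ioc]
    omega
  have hcard := Finset.card_le_card hsub
  rw [card_filter_coprime_Ico_add_mul] at hcard
  have hcard' : (K : ℝ) * P.totient ≤ ((Finset.Ioc s t).filter P.Coprime).card := by
    exact_mod_cast hcard
  have hK : H - 1 - P ≤ K * P := by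
    have h1 : t - s < P * (K + 1) := Nat.lt_mul_div_succ _ (Nat.pos_of_ne_zero hP)
    have h2 : (t : ℝ) < s + P * (K + 1) := by exact_mod_cast (by omega : t < s + P * (K + 1))
    have h3 : a + H < t + 1 := Nat.lt_floor_add_one _
    have h4 : (s : ℝ) ≤ a := Nat.floor_le ha
    linarith
  have hφ : (P.totient : ℝ) / P ≤ 1 := by
    rw [div_le_one (by linarith)]; exact_mod_cast Nat.totient_le P
  have hφ0 : 0 ≤ (P.totient : ℝ) / P := by positivity
  calc (P.totient : ℝ) / P * H - 2 * P ≤ (P.totient : ℝ) / P * (H - 1 - P) := by nlinarith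
    _ ≤ (P.totient : ℝ) / P * (K * P) := by gcongr
    _ = K * P.totient := by field_simp
    _ ≤ _ := hcard'

/-- From φ(P)/P = ∏ (1 - 1/p) and 1 - t ≥ exp(-2t) on [0, 1/2]. The bound involves only the
reciprocal sum, so the sieve density does not degrade as more primes of a convergent family are
sieved. -/
theorem exp_neg_le_totient_div {S : Finset ℕ} (hS : ∀ p ∈ S, p.Prime) :
    Real.exp (-2 * ∑ p ∈ S, (p : ℝ)⁻¹) ≤ ((∏ p ∈ S, p).totient : ℝ) / ((∏ p ∈ S, p : ℕ) : ℝ) := by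
  have h0 : (∏ p ∈ S, p) ≠ 0 := Finset.prod_ne_zero_iff.mpr fun p hp ↦ (hS p hp).ne_zero
  have h1 : ((∏ p ∈ S, p).totient : ℝ) =
      ((∏ p ∈ S, p : ℕ) : ℝ) * ∏ p ∈ S, (1 - (p : ℝ)⁻¹) := by
    have := Nat.totient_eq_mul_prod_factors (∏ p ∈ S, p)
    rw [Nat.primeFactors_prod hS] at this
    rw [← Rat.cast_natCast, this]
    push_cast
    rfl
  rw [h1, mul_div_cancel_left₀ _ (Nat.cast_ne_zero.mpr h0), Finset.mul_sum, Real.exp_sum]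
  refine Finset.prod_le_prod (fun _ _ ↦ (Real.exp_pos _).le) fun p hp ↦ ?_
  have hp2 : (2 : ℝ) ≤ p := by exact_mod_cast (hS p hp).two_le
  set t : ℝ := (p : ℝ)⁻¹
  have ht0 : 0 < t := by positivity
  have ht : t ≤ 1 / 2 := by
    rw [one_div]; exact inv_anti₀ (by norm_num) hp2
  have h2 : 1 + 2 * t ≤ Real.exp (2 * t) := by linarith [Real.add_one_le_exp (2 * t)]
  rw [neg_mul, Real.exp_neg, inv_le_comm₀ (Real.exp_pos _) (by linarith)]
  refine le_trans ?_ h2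
  rw [inv_le_iff_one_le_mul₀ (by linarith)]
  nlinarith

theorem card_filter_dvd_Ioc_le {x y : ℝ} (hx : 0 ≤ x) (hy : 0 ≤ y) {p : ℕ} (hp : p ≠ 0) :
    (((Finset.Ioc ⌊x⌋₊ ⌊x + y⌋₊).filter (p ∣ ·)).card : ℝ) ≤ y * (p : ℝ)⁻¹ + 1 := by
  have hp0 : (0 : ℝ) < p := by exact_mod_cast Nat.pos_of_ne_zero hp
  have hle : x / p ≤ (x + y) / p := by gcongr; linarith
  have h1 : ((Finset.Ioc ⌊x⌋₊ ⌊x + y⌋₊).filter (p ∣ ·)).card ≤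
      (Finset.Ioc ⌊x / p⌋₊ ⌊(x + y) / p⌋₊).card := by
    refine Finset.card_le_card_of_injOn (· / p) (fun n hn ↦ ?_) fun m hm n hn hmn ↦ ?_
    · rw [Finset.mem_coe, Finset.mem_filter, Finset.mem_Ioc, Nat.floor_lt hx,
        Nat.le_floor_iff (by linarith)] at hn
      obtain ⟨⟨hn1, hn2⟩, l, rfl⟩ := hn
      push_cast at hn1 hn2
      rw [Finset.mem_coe, Finset.mem_Ioc, Nat.floor_lt (by positivity),
        Nat.le_floor_iff (by positivity), div_lt_iff₀' hp0, le_div_iff₀' hp0]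
      simp only [Nat.mul_div_cancel_left _ (Nat.pos_of_ne_zero hp)]
      exact ⟨hn1, hn2⟩
    · rw [Finset.mem_coe, Finset.mem_filter] at hm hn
      exact (Nat.div_left_inj hm.2 hn.2).mp hmn
  have h2 : ((Finset.Ioc ⌊x / p⌋₊ ⌊(x + y) / p⌋₊).card : ℝ) ≤ y * (p : ℝ)⁻¹ + 1 := by
    rw [Nat.card_Ioc, Nat.cast_sub (Nat.floor_le_floor hle)]
    have h3 : (⌊(x + y) / p⌋₊ : ℝ) ≤ (x + y) / p := Nat.floor_le (by positivity)
    have h4 : x / p < ⌊x / p⌋₊ + 1 := Nat.lt_floor_add_one _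
    have h5 : (x + y) / p = x / p + y * (p : ℝ)⁻¹ := by rw [add_div]; rfl
    linarith
  exact le_trans (by exact_mod_cast h1) h2

/-- The distinct primes of Q dividing n have product at most n. This bounds the number of
representations n = q * l. -/
theorem card_filter_prime_dvd_mul_log_le {Q : Finset ℕ} {u X : ℝ} (hu : 1 < u)
    (hQ : ∀ q ∈ Q, q.Prime ∧ u < q) {n : ℕ} (hn : n ≠ 0) (hnX : n ≤ X) :
    ((Q.filter (· ∣ n)).card : ℝ) * Real.log u ≤ Real.log X := by
  have hdvd : ∏ q ∈ Q.filter (· ∣ n), q ∣ n :=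
    Finset.prod_primes_dvd n (fun q hq ↦ (hQ q (Finset.mem_filter.mp hq).1).1.prime)
      fun q hq ↦ (Finset.mem_filter.mp hq).2
  have h1 : u ^ (Q.filter (· ∣ n)).card ≤ X := by
    calc u ^ (Q.filter (· ∣ n)).card = ∏ q ∈ Q.filter (· ∣ n), u := by simp
      _ ≤ ∏ q ∈ Q.filter (· ∣ n), (q : ℝ) :=
        Finset.prod_le_prod (fun _ _ ↦ by linarith) fun q hq ↦ (hQ q (Finset.mem_filter.mp hq).1).2.le
      _ ≤ n := by
        rw [← Nat.cast_prod]
        exact_mod_cast Nat.le_of_dvd (Nat.pos_of_ne_zero hn) hdvd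
      _ ≤ X := hnX
  rw [← Real.log_pow]
  exact Real.log_le_log (by positivity) h1

/-- Double counting of the products `q * l` in `(x, x + y]`. -/
theorem sum_card_coprime_le {Q : Finset ℕ} (hQ : ∀ q ∈ Q, 0 < q) {x y r : ℝ} (hx : 0 ≤ x)
    (hy : 0 ≤ y) (P : ℕ)
    (hr : ∀ n : ℕ, x < n → n ≤ x + y → ((Q.filter (· ∣ n)).card : ℝ) ≤ r) :
    ∑ q ∈ Q, (((Finset.Ioc ⌊x / q⌋₊ ⌊x / q + y / q⌋₊).filter P.Coprime).card : ℝ) ≤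
      r * ((Finset.Ioc ⌊x⌋₊ ⌊x + y⌋₊).filter
        fun n ↦ ∃ q ∈ Q, q ∣ n ∧ P.Coprime (n / q)).card := by
  set T := (Finset.Ioc ⌊x⌋₊ ⌊x + y⌋₊).filter fun n ↦ ∃ q ∈ Q, q ∣ n ∧ P.Coprime (n / q)
  have h1 : ∀ q ∈ Q, ((Finset.Ioc ⌊x / q⌋₊ ⌊x / q + y / q⌋₊).filter P.Coprime).card ≤
      (T.filter (q ∣ ·)).card := by
    intro q hq
    have hq0 : (0 : ℝ) < q := by exact_mod_cast hQ q hq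
    refine Finset.card_le_card_of_injOn (q * ·) (fun l hl ↦ ?_) fun a _ b _ hab ↦
      Nat.eq_of_mul_eq_mul_left (hQ q hq) hab
    rw [Finset.mem_coe, Finset.mem_filter, Finset.mem_Ioc, Nat.floor_lt (by positivity),
      Nat.le_floor_iff (by positivity), ← add_div, div_lt_iff₀' hq0, le_div_iff₀' hq0] at hl
    rw [Finset.mem_coe, Finset.mem_filter, Finset.mem_filter, Finset.mem_Ioc, Nat.floor_lt hx,
      Nat.le_floor_iff (by positivity)]
    push_cast
    refine ⟨⟨hl.1, q, hq, dvd_mul_right _ _, ?_⟩, dvd_mul_right _ _⟩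
    rw [Nat.mul_div_cancel_left _ (hQ q hq)]
    exact hl.2
  have h2 : ∑ q ∈ Q, (T.filter (q ∣ ·)).card = ∑ n ∈ T, (Q.filter (· ∣ n)).card :=
    Finset.sum_card_bipartiteAbove_eq_sum_card_bipartiteBelow (fun q n ↦ q ∣ n)
  calc _ ≤ ∑ q ∈ Q, ((T.filter (q ∣ ·)).card : ℝ) :=
        Finset.sum_le_sum fun q hq ↦ by exact_mod_cast h1 q hq
    _ = ∑ n ∈ T, ((Q.filter (· ∣ n)).card : ℝ) := by exact_mod_cast h2
    _ ≤ ∑ n ∈ T, r := Finset.sum_le_sum fun n hn ↦ by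
        rw [Finset.mem_filter, Finset.mem_Ioc, Nat.floor_lt hx,
          Nat.le_floor_iff (by positivity)] at hn
        exact hr n hn.1.1 hn.1.2
    _ = r * T.card := by rw [Finset.sum_const, nsmul_eq_mul, mul_comm]

end KRW

end

/-! ### The sieve for `B`-free numbers in short intervals -/

noncomputable section

namespace KRW

open Filter

open Classical in
/-- Lower bound for `B`-free numbers in `(x, x + y]` from products `q * l` with `q` a prime in
`(u, w]`; here `B` is a set of primes and `G` a sieving threshold. -/
theorem card_free_ge {B : Set ℕ} (hB : ∀ p ∈ B, p.Prime) {S τ u w x y R : ℝ} {G : ℕ}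
    (hS : ∑ p ∈ (Finset.range (G + 1)).filter (· ∈ B), (p : ℝ)⁻¹ ≤ S)
    (hτ : ∀ T : Finset ℕ, (∀ p ∈ T, p ∈ B ∧ G < p) → ∑ p ∈ T, (p : ℝ)⁻¹ ≤ τ)
    (hu : 1 < u) (hGu : G ≤ u) (hx : 0 < x) (hy : 0 ≤ y) (hyx : y ≤ x)
    (hw : 0 ≤ w) (hwR : w ≤ R) (hxR : 2 * x / u ≤ R) {r : ℝ} (hr0 : 0 < r)
    (hr : Real.log (2 * x) ≤ r * Real.log u) :
    (Real.exp (-2 * S) * (∑ q ∈ primesIoc u w, (q : ℝ)⁻¹) * y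
      - 2 * (∏ p ∈ (Finset.range (G + 1)).filter (· ∈ B), p : ℕ) * w) / r - τ * y -
        ({p | p ∈ B ∧ (p : ℝ) ≤ R}.ncard : ℝ) ≤
      ((Finset.Ioc ⌊x⌋₊ ⌊x + y⌋₊).filter (fun n ↦ ∀ p ∈ B, ¬ p ∣ n)).card := by
  set F := (Finset.range (G + 1)).filter (· ∈ B)
  set P := ∏ p ∈ F, p with hPdef
  set Q := primesIoc u w
  have hF : ∀ p ∈ F, p.Prime := fun p hp ↦ hB p (Finset.mem_filter.mp hp).2
  have hP0 : P ≠ 0 := Finset.prod_ne_zero_iff.mpr fun p hp ↦ (hF p hp).ne_zero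
  have hQ : ∀ q ∈ Q, q.Prime ∧ u < q := fun q hq ↦ by
    rw [mem_primesIoc (by linarith) hw] at hq; exact ⟨hq.2.2, hq.1⟩
  have hlogu : 0 < Real.log u := Real.log_pos hu
  -- Candidates: products q * l with l free of the small primes of `B`. They may still be divisible
  -- by larger ones.
  set T := (Finset.Ioc ⌊x⌋₊ ⌊x + y⌋₊).filter fun n ↦ ∃ q ∈ Q, q ∣ n ∧ P.Coprime (n / q)
  have hT : (Real.exp (-2 * S) * (∑ q ∈ Q, (q : ℝ)⁻¹) * y - 2 * P * w) / r ≤ T.card := by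
    rw [div_le_iff₀' hr0]
    refine le_trans ?_ (sum_card_coprime_le (fun q hq ↦ (hQ q hq).1.pos) hx.le hy P
      (fun n hn1 hn2 ↦ ?_))
    · have hV : Real.exp (-2 * S) ≤ (P.totient : ℝ) / P := by
        refine le_trans (Real.exp_le_exp.mpr ?_) (exp_neg_le_totient_div hF)
        linarith
      have hcardQ : (Q.card : ℝ) ≤ w := by
        calc (Q.card : ℝ) ≤ (Finset.Ioc 0 ⌊w⌋₊).card := by
              refine Nat.cast_le.mpr (Finset.card_le_card ((Finset.filter_subset _ _).trans
                (Finset.Ioc_subset_Ioc_left (Nat.zero_le _))))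
          _ ≤ w := by rw [Nat.card_Ioc, Nat.sub_zero]; exact Nat.floor_le hw
      calc Real.exp (-2 * S) * (∑ q ∈ Q, (q : ℝ)⁻¹) * y - 2 * P * w
          ≤ Real.exp (-2 * S) * (∑ q ∈ Q, (q : ℝ)⁻¹) * y - 2 * P * Q.card := by gcongr
        _ = ∑ q ∈ Q, (Real.exp (-2 * S) * (y / q) - 2 * P) := by
          rw [Finset.sum_sub_distrib, Finset.sum_const, nsmul_eq_mul, mul_assoc, Finset.sum_mul,
            Finset.mul_sum]
          congr 1
          · refine Finset.sum_congr rfl fun q _ ↦ ?_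
            rw [div_eq_inv_mul]
          · ring
        _ ≤ _ := Finset.sum_le_sum fun q hq ↦ by
          refine le_trans ?_ (le_card_coprime_Ioc hP0 (by positivity) (by positivity))
          gcongr
    · have hn0 : n ≠ 0 := by
        rintro rfl
        simp only [Nat.cast_zero] at hn1
        linarith
      have := card_filter_prime_dvd_mul_log_le hu hQ hn0 (hn2.trans (by linarith : x + y ≤ 2 * x))
      exact le_of_mul_le_mul_right (this.trans hr) hlogu
  have hfin : {p | p ∈ B ∧ (p : ℝ) ≤ R}.Finite :=
    (Set.finite_Iic ⌊R⌋₊).subset fun p hp ↦ Nat.le_floor hp.2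
  set E := hfin.toFinset.filter (G < ·)
  have hE : ∀ p ∈ E, p ∈ B ∧ G < p := fun p hp ↦ by
    rw [Finset.mem_filter, Set.Finite.mem_toFinset] at hp; exact ⟨hp.1.1, hp.2⟩
  -- The integers to discard: multiples of primes of `B` in (G, R].
  set D := E.biUnion fun p ↦ (Finset.Ioc ⌊x⌋₊ ⌊x + y⌋₊).filter (p ∣ ·)
  have hEcard : (E.card : ℝ) ≤ ({p | p ∈ B ∧ (p : ℝ) ≤ R}.ncard : ℝ) := by
    rw [Set.ncard_eq_toFinset_card _ hfin]
    exact_mod_cast Finset.card_filter_le _ _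
  have hD : (D.card : ℝ) ≤ τ * y + ({p | p ∈ B ∧ (p : ℝ) ≤ R}.ncard : ℝ) := by
    calc (D.card : ℝ) ≤ ∑ p ∈ E, (((Finset.Ioc ⌊x⌋₊ ⌊x + y⌋₊).filter (p ∣ ·)).card : ℝ) := by
          exact_mod_cast Finset.card_biUnion_le
      _ ≤ ∑ p ∈ E, (y * (p : ℝ)⁻¹ + 1) := Finset.sum_le_sum fun p hp ↦
          card_filter_dvd_Ioc_le hx.le hy (hB p (hE p hp).1).ne_zero
      _ = (∑ p ∈ E, (p : ℝ)⁻¹) * y + E.card := by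
          rw [Finset.sum_add_distrib, ← Finset.mul_sum, mul_comm]; simp
      _ ≤ _ := by gcongr; exact hτ E hE
  -- A prime of `B` dividing q * l is q or divides l. It exceeds G because q > u ≥ G and l is
  -- coprime to P, and it is at most R because q ≤ w and l ≤ 2x/u.
  have hsub : T \ D ⊆ (Finset.Ioc ⌊x⌋₊ ⌊x + y⌋₊).filter (fun n ↦ ∀ p ∈ B, ¬ p ∣ n) := by
    intro n hn
    rw [Finset.mem_sdiff, Finset.mem_filter] at hn
    obtain ⟨⟨hnI, q, hq, ⟨l, rfl⟩, hcop⟩, hnD⟩ := hn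
    refine Finset.mem_filter.mpr ⟨hnI, fun p hp hdvd ↦ hnD ?_⟩
    have hqp := (hQ q hq).1
    rw [Nat.mul_div_cancel_left _ hqp.pos] at hcop
    have hpp := hB p hp
    have hq' := (mem_primesIoc (by linarith) hw).mp hq
    have hI := hnI
    rw [Finset.mem_Ioc, Nat.floor_lt hx.le, Nat.le_floor_iff (by positivity)] at hI
    push_cast at hI
    have hl0 : 0 < l := by
      rcases Nat.eq_zero_or_pos l with rfl | h
      · simp only [Nat.cast_zero, mul_zero] at hI; linarith
      · exact h
    have hl : (l : ℝ) ≤ 2 * x / u := by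
      rw [le_div_iff₀' (by linarith)]
      nlinarith [hq'.1, (by exact_mod_cast hl0 : (0 : ℝ) < l)]
    have hcases : p = q ∨ p ∣ l := by
      rcases hpp.dvd_mul.mp hdvd with h | h
      · exact Or.inl ((Nat.prime_dvd_prime_iff_eq hpp hqp).mp h)
      · exact Or.inr h
    have hGp : G < p := by
      by_contra! hle
      rcases hcases with rfl | h
      · have : (p : ℝ) ≤ G := by exact_mod_cast hle
        linarith [hq'.1]
      · have hpF : p ∈ F := Finset.mem_filter.mpr ⟨Finset.mem_range.mpr (by omega), hp⟩
        exact hpp.one_lt.ne' (Nat.eq_one_of_dvd_coprimes hcop (Finset.dvd_prod_of_mem _ hpF) h)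
    have hpR : (p : ℝ) ≤ R := by
      rcases hcases with rfl | h
      · exact hq'.2.1.trans hwR
      · have : (p : ℝ) ≤ l := by exact_mod_cast Nat.le_of_dvd hl0 h
        linarith
    exact Finset.mem_biUnion.mpr ⟨p, Finset.mem_filter.mpr ⟨hfin.mem_toFinset.mpr ⟨hp, hpR⟩, hGp⟩,
      Finset.mem_filter.mpr ⟨hnI, hdvd⟩⟩
  have h1 : (T.card : ℝ) - D.card ≤ (T \ D).card := by
    have := Finset.le_card_sdiff D T
    rw [Nat.sub_le_iff_le_add] at this
    have : (T.card : ℝ) ≤ (T \ D).card + D.card := by exact_mod_cast this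
    linarith
  have h2 : ((T \ D).card : ℝ) ≤
      ((Finset.Ioc ⌊x⌋₊ ⌊x + y⌋₊).filter (fun n ↦ ∀ p ∈ B, ¬ p ∣ n)).card := by
    exact_mod_cast Finset.card_le_card hsub
  linarith

open Classical in
-- Choice of parameters: u = x^(θ + ε/4) and w = x^(θ + ε/2) make every error of size O(w),
-- negligible against y ≥ x^(θ + ε).
theorem exists_card_free_ge_of_le {B : Set ℕ} (hB : ∀ p ∈ B, p.Prime)
    (hsum : Summable (B.indicator fun n : ℕ ↦ (n : ℝ)⁻¹)) {ρ ε A : ℝ} (hρ0 : 0 ≤ ρ) (hρ1 : ρ ≤ 1)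
    (hε : 0 < ε) (hε1 : ε ≤ 1 / 4)
    (hA : ∀ X : ℝ, 1 ≤ X → ({p | p ∈ B ∧ (p : ℝ) ≤ X}.ncard : ℝ) ≤ A * X ^ (ρ + ε / 2)) :
    ∃ c > 0, ∀ᶠ x : ℝ in atTop, ∀ y, x ^ (ρ / (1 + ρ) + ε) ≤ y → y ≤ x →
      c * y ≤ ((Finset.Ioc ⌊x⌋₊ ⌊x + y⌋₊).filter (fun n ↦ ∀ p ∈ B, ¬ p ∣ n)).card := by
  set θ := ρ / (1 + ρ) with hθ
  have hθ0 : 0 ≤ θ := by positivity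
  have hθ1 : θ ≤ 1 / 2 := by rw [hθ, div_le_iff₀ (by linarith)]; linarith
  -- The equation balancing w against the number of bad primes up to x^(1 - θ).
  have hθρ : (1 - θ) * ρ = θ := by rw [hθ]; field_simp; ring
  have hnn : ∀ n, 0 ≤ B.indicator (fun n : ℕ ↦ (n : ℝ)⁻¹) n := fun n ↦
    Set.indicator_nonneg (fun _ _ ↦ by positivity) n
  have hA0 : 0 ≤ A := by simpa using le_trans (Nat.cast_nonneg _) (hA 1 le_rfl)
  obtain ⟨c₁, hc₁, hM⟩ := exists_sum_inv_primes_ge (a := θ + ε / 4) (b := θ + ε / 2)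
    (by positivity) (by linarith)
  set S := ∑' n, B.indicator (fun n : ℕ ↦ (n : ℝ)⁻¹) n
  -- Built from the full sum S, hence independent of G; this lets G be chosen afterwards with tail
  -- at most c₂ / 4. The factor ε / 8 is the inverse of the multiplicity bound r.
  set c₂ := Real.exp (-2 * S) * c₁ * (ε / 8) with hc₂def
  have hc₂ : 0 < c₂ := by positivity
  obtain ⟨s, hs⟩ := summable_iff_vanishing_norm.mp hsum (c₂ / 4) (by positivity)
  set G := s.sup id
  have hsumB : ∀ T : Finset ℕ, (∀ p ∈ T, p ∈ B) →
      ∑ p ∈ T, (p : ℝ)⁻¹ = ∑ p ∈ T, B.indicator (fun n : ℕ ↦ (n : ℝ)⁻¹) p := fun T hT ↦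
    Finset.sum_congr rfl fun p hp ↦ (Set.indicator_of_mem (hT p hp) (fun n : ℕ ↦ (n : ℝ)⁻¹)).symm
  have hτ : ∀ T : Finset ℕ, (∀ p ∈ T, p ∈ B ∧ G < p) → ∑ p ∈ T, (p : ℝ)⁻¹ ≤ c₂ / 4 := by
    intro T hT
    rw [hsumB T fun p hp ↦ (hT p hp).1]
    refine (le_of_abs_le (hs T (Finset.disjoint_left.mpr fun p hp hps ↦ ?_)).le)
    exact absurd (hT p hp).2 (not_lt.mpr (Finset.le_sup (f := id) hps))
  have hS : ∑ p ∈ (Finset.range (G + 1)).filter (· ∈ B), (p : ℝ)⁻¹ ≤ S := by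
    rw [hsumB _ fun p hp ↦ (Finset.mem_filter.mp hp).2]
    exact hsum.sum_le_tsum _ fun n _ ↦ hnn n
  set P := ∏ p ∈ (Finset.range (G + 1)).filter (· ∈ B), p
  refine ⟨c₂ / 2, by positivity, ?_⟩
  have hexp4 : 0 < θ + ε / 4 := by positivity
  filter_upwards [hM, eventually_ge_atTop 2,
    (tendsto_rpow_atTop hexp4).eventually (eventually_ge_atTop (G : ℝ)),
    (tendsto_rpow_atTop (show 0 < ε / 2 by positivity)).eventually
      (eventually_ge_atTop ((2 * P + 1 + 4 * A) * 4 / c₂))] with x hM hx2 hGu hbig y hy hyx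
  have hx0 : 0 < x := by linarith
  have hx1 : 1 < x := by linarith
  have hy0 : 0 ≤ y := le_trans (by positivity) hy
  set u := x ^ (θ + ε / 4) with hu
  set w := x ^ (θ + ε / 2) with hw
  have hu1 : 1 < u := Real.one_lt_rpow hx1 hexp4
  have hw1 : 1 ≤ w := Real.one_le_rpow hx1.le (by positivity)
  set R₁ := 2 * x ^ (1 - θ) with hR₁
  have hxpow1 : 1 ≤ x ^ (1 - θ) := Real.one_le_rpow hx1.le (by linarith)
  have hxu : 2 * x / u ≤ max w R₁ := by
    refine le_trans ?_ (le_max_right _ _)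
    rw [hR₁, hu, mul_div_assoc]
    have : x / x ^ (θ + ε / 4) = x ^ (1 - (θ + ε / 4)) := by
      rw [Real.rpow_sub hx0, Real.rpow_one]
    rw [this]
    gcongr
    · exact hx1.le
    · linarith
  have hlogx : 0 < Real.log x := Real.log_pos hx1
  have hr : Real.log (2 * x) ≤ 8 / ε * Real.log u := by
    have h1 : Real.log (2 * x) ≤ 2 * Real.log x := by
      rw [Real.log_mul (by norm_num) hx0.ne']
      linarith [Real.log_le_log (by norm_num) hx2]
    have h2 : ε / 4 * Real.log x ≤ Real.log u := by
      rw [hu, Real.log_rpow hx0]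
      gcongr
      linarith
    calc Real.log (2 * x) ≤ 2 * Real.log x := h1
      _ = 8 / ε * (ε / 4 * Real.log x) := by field_simp; norm_num
      _ ≤ _ := by gcongr
  have hkey := card_free_ge hB hS hτ hu1 hGu hx0 hy0 hyx (by linarith) (le_max_left w R₁) hxu
    (r := 8 / ε) (by positivity) hr
  refine le_trans ?_ hkey
  -- Up to w the trivial count is enough; the density hypothesis is needed only up to R₁.
  have hcount : ({p | p ∈ B ∧ (p : ℝ) ≤ max w R₁}.ncard : ℝ) ≤ (1 + 4 * A) * w := by
    have hsub : {p | p ∈ B ∧ (p : ℝ) ≤ max w R₁} ⊆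
        (Finset.Ioc 0 ⌊w⌋₊ : Finset ℕ) ∪ {p | p ∈ B ∧ (p : ℝ) ≤ R₁} := by
      rintro p ⟨hp, hpR⟩
      rcases le_max_iff.mp hpR with h | h
      · exact Or.inl (by simpa using ⟨(hB p hp).pos, Nat.le_floor h⟩)
      · exact Or.inr ⟨hp, h⟩
    have hfin : {p | p ∈ B ∧ (p : ℝ) ≤ R₁}.Finite :=
      (Set.finite_Iic ⌊R₁⌋₊).subset fun p hp ↦ Nat.le_floor hp.2
    have h1 := (Set.ncard_le_ncard hsub ((Finset.finite_toSet _).union hfin)).trans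
      (Set.ncard_union_le _ _)
    rw [Set.ncard_coe_finset, Nat.card_Ioc, Nat.sub_zero] at h1
    have h2 : (⌊w⌋₊ : ℝ) ≤ w := Nat.floor_le (by linarith)
    have h3 := hA R₁ (by linarith)
    have h4 : R₁ ^ (ρ + ε / 2) ≤ 4 * w := by
      rw [hR₁, Real.mul_rpow (by norm_num) (by positivity), ← Real.rpow_mul hx0.le]
      gcongr
      · calc (2 : ℝ) ^ (ρ + ε / 2) ≤ 2 ^ (2 : ℝ) :=
              Real.rpow_le_rpow_of_exponent_le (by norm_num) (by linarith)
          _ = 4 := by norm_num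
      · exact Real.rpow_le_rpow_of_exponent_le hx1.le (by nlinarith)
    have h5 : A * R₁ ^ (ρ + ε / 2) ≤ A * (4 * w) := by gcongr
    have h6 : ({p | p ∈ B ∧ (p : ℝ) ≤ max w R₁}.ncard : ℝ) ≤
        ⌊w⌋₊ + ({p | p ∈ B ∧ (p : ℝ) ≤ R₁}.ncard : ℝ) := by exact_mod_cast h1
    linarith
  have hwy : (2 * P + 1 + 4 * A) * w ≤ c₂ / 4 * y := by
    have h1 : (2 * P + 1 + 4 * A) ≤ c₂ / 4 * x ^ (ε / 2) := by
      rw [div_le_iff₀ hc₂] at hbig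
      linarith
    calc (2 * P + 1 + 4 * A) * w ≤ c₂ / 4 * x ^ (ε / 2) * w := by gcongr
      _ = c₂ / 4 * x ^ (θ + ε) := by
        rw [hw, mul_assoc, ← Real.rpow_add hx0]; congr 2; ring
      _ ≤ _ := by gcongr
  have hmain : c₂ * y - 2 * P * w ≤
      (Real.exp (-2 * S) * (∑ q ∈ primesIoc u w, (q : ℝ)⁻¹) * y - 2 * P * w) / (8 / ε) := by
    rw [div_div_eq_mul_div, le_div_iff₀ (by norm_num)]
    have h1 : Real.exp (-2 * S) * c₁ * y ≤
        Real.exp (-2 * S) * (∑ q ∈ primesIoc u w, (q : ℝ)⁻¹) * y := by gcongr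
    have h2 : c₂ * y * 8 = Real.exp (-2 * S) * c₁ * y * ε := by rw [hc₂def]; ring
    have h3 : 0 ≤ 2 * (P : ℝ) * w := by positivity
    nlinarith
  linarith

end KRW

end

/-! ### From the counting bound to summability and arbitrary interval lengths -/

noncomputable section

namespace KRW

open Filter Asymptotics

theorem eventually_log_log_rpow_div_le (Θ Ψ : ℝ) {τ : ℝ} (hτ : 0 < τ) :
    ∀ᶠ x : ℝ in atTop,
      Real.log (Real.log x) ^ Ψ / Real.log x ^ Θ ≤ Real.log x ^ (τ - Θ) := by
  have h := ((isLittleO_log_rpow_rpow_atTop Ψ hτ).comp_tendsto Real.tendsto_log_atTop).def one_pos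
  filter_upwards [h, Real.tendsto_log_atTop.eventually (eventually_gt_atTop 0)] with x hx hlog
  simp only [Function.comp, Real.norm_eq_abs, one_mul] at hx
  rw [abs_of_pos (Real.rpow_pos_of_pos hlog τ)] at hx
  rw [Real.rpow_sub hlog]
  gcongr
  exact le_of_abs_le hx

theorem eventually_log_rpow_le_rpow (a : ℝ) {δ : ℝ} (hδ : 0 < δ) :
    ∀ᶠ x : ℝ in atTop, Real.log x ^ a ≤ x ^ δ := by
  filter_upwards [(isLittleO_log_rpow_rpow_atTop a hδ).def one_pos, eventually_gt_atTop 0]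
    with x hx hx0
  rw [one_mul, Real.norm_eq_abs, Real.norm_eq_abs, abs_of_pos (Real.rpow_pos_of_pos hx0 δ)] at hx
  exact le_of_abs_le hx

variable {B : Set ℕ}

theorem ncard_le_self (hB : ∀ p ∈ B, p ≠ 0) {X : ℝ} (hX : 0 ≤ X) :
    ({p | p ∈ B ∧ (p : ℝ) ≤ X}.ncard : ℝ) ≤ X := by
  have hsub : {p | p ∈ B ∧ (p : ℝ) ≤ X} ⊆ (Finset.Ioc 0 ⌊X⌋₊ : Finset ℕ) := fun p hp ↦ by
    simpa using ⟨Nat.pos_of_ne_zero (hB p hp.1), Nat.le_floor hp.2⟩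
  have h := Set.ncard_le_ncard hsub (Finset.finite_toSet _)
  rw [Set.ncard_coe_finset, Nat.card_Ioc, Nat.sub_zero] at h
  exact (Nat.cast_le.mpr h).trans (Nat.floor_le hX)

theorem exists_ncard_le_rpow (hB : ∀ p ∈ B, p ≠ 0) {ρ Θ Ψ A : ℝ} (hρ : 0 ≤ ρ)
    (h : ∀ x : ℝ, 3 ≤ x → ({p : ℕ | p ∈ B ∧ (p : ℝ) ≤ x}.ncard : ℝ) ≤
      A * (x ^ ρ * Real.log (Real.log x) ^ Ψ / Real.log x ^ Θ)) {δ : ℝ} (hδ : 0 < δ) :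
    ∃ A' : ℝ, ∀ X : ℝ, 1 ≤ X → ({p | p ∈ B ∧ (p : ℝ) ≤ X}.ncard : ℝ) ≤ A' * X ^ (ρ + δ) := by
  obtain ⟨X₁, hX₁⟩ := ((eventually_log_log_rpow_div_le Θ Ψ one_pos).and
    ((eventually_log_rpow_le_rpow (1 - Θ) hδ).and (eventually_ge_atTop 3))).exists_forall_of_atTop
  have hX₁3 := (hX₁ X₁ le_rfl).2.2
  refine ⟨|A| + X₁, fun X hX ↦ ?_⟩
  have hX0 : 0 < X := by linarith
  have h1 : 1 ≤ X ^ (ρ + δ) := Real.one_le_rpow hX (by linarith)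
  have hA0 := abs_nonneg A
  rcases le_total X₁ X with hle | hle
  · obtain ⟨h2, h3, h4⟩ := hX₁ X hle
    have hlog : 0 < Real.log X := Real.log_pos (by linarith)
    have hloglog : 0 ≤ Real.log (Real.log X) := by
      refine Real.log_nonneg ?_
      rw [Real.le_log_iff_exp_le hX0]
      linarith [Real.exp_one_lt_d9]
    calc ({p | p ∈ B ∧ (p : ℝ) ≤ X}.ncard : ℝ)
        ≤ A * (X ^ ρ * Real.log (Real.log X) ^ Ψ / Real.log X ^ Θ) := h X h4
      _ ≤ |A| * (X ^ ρ * (Real.log (Real.log X) ^ Ψ / Real.log X ^ Θ)) := by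
        rw [mul_div_assoc]
        gcongr
        exact le_abs_self A
      _ ≤ |A| * (X ^ ρ * X ^ δ) := by
        gcongr
        exact h2.trans h3
      _ = |A| * X ^ (ρ + δ) := by rw [Real.rpow_add hX0]
      _ ≤ _ := by gcongr; linarith
  · calc ({p | p ∈ B ∧ (p : ℝ) ≤ X}.ncard : ℝ) ≤ X := ncard_le_self hB hX0.le
      _ ≤ (|A| + X₁) * 1 := by linarith
      _ ≤ _ := by gcongr

theorem sum_range_two_pow_indicator_le (n : ℕ) :
    ∑ i ∈ Finset.range (2 ^ n), B.indicator (fun n : ℕ ↦ (n : ℝ)⁻¹) i ≤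
      ∑ j ∈ Finset.range n, ({p | p ∈ B ∧ (p : ℝ) ≤ 2 ^ (j + 1)}.ncard : ℝ) / 2 ^ j := by
  classical
  induction n with
  -- The only index is 0, and its term vanishes since 0⁻¹ = 0.
  | zero => simp [Set.indicator]
  | succ n ih =>
    have hle : 2 ^ n ≤ 2 ^ (n + 1) := Nat.pow_le_pow_right two_pos n.le_succ
    rw [Finset.sum_range_succ _ n, Finset.range_eq_Ico,
      ← Finset.sum_Ico_consecutive _ (Nat.zero_le _) hle, ← Finset.range_eq_Ico]
    refine add_le_add ih ?_
    have hfin : {p | p ∈ B ∧ (p : ℝ) ≤ 2 ^ (n + 1)}.Finite :=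
      (Set.finite_Iic (2 ^ (n + 1))).subset fun p hp ↦ by
        have := hp.2
        exact_mod_cast this
    calc ∑ i ∈ Finset.Ico (2 ^ n) (2 ^ (n + 1)), B.indicator (fun n : ℕ ↦ (n : ℝ)⁻¹) i
        = ∑ i ∈ (Finset.Ico (2 ^ n) (2 ^ (n + 1))).filter (· ∈ B), (i : ℝ)⁻¹ := by
          rw [Finset.sum_filter]
          exact Finset.sum_congr rfl fun i _ ↦ by simp [Set.indicator_apply]
      _ ≤ ∑ i ∈ (Finset.Ico (2 ^ n) (2 ^ (n + 1))).filter (· ∈ B), ((2 : ℝ) ^ n)⁻¹ := by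
          refine Finset.sum_le_sum fun i hi ↦ ?_
          rw [Finset.mem_filter, Finset.mem_Ico] at hi
          have : (2 : ℝ) ^ n ≤ i := by exact_mod_cast hi.1.1
          gcongr
      _ = ((Finset.Ico (2 ^ n) (2 ^ (n + 1))).filter (· ∈ B)).card / 2 ^ n := by
          rw [Finset.sum_const, nsmul_eq_mul, div_eq_mul_inv]
      _ ≤ _ := by
          gcongr
          rw [← Set.ncard_coe_finset]
          refine Set.ncard_le_ncard (fun i hi ↦ ?_) hfin
          rw [Finset.mem_coe, Finset.mem_filter, Finset.mem_Ico] at hi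
          exact ⟨hi.2, by exact_mod_cast hi.1.2.le⟩

/-- Dyadic decomposition: the block starting at 2^j contributes O((j + 1)^(-s)), and s > 1. -/
theorem summable_indicator_inv {A s : ℝ} (hs : 1 < s)
    (h : ∀ᶠ x : ℝ in atTop, ({p : ℕ | p ∈ B ∧ (p : ℝ) ≤ x}.ncard : ℝ) ≤
      A * (x * Real.log x ^ (-s))) :
    Summable (B.indicator fun n : ℕ ↦ (n : ℝ)⁻¹) := by
  set b : ℕ → ℝ := fun j ↦ ({p | p ∈ B ∧ (p : ℝ) ≤ 2 ^ (j + 1)}.ncard : ℝ) / 2 ^ j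
  have hb0 : ∀ j, 0 ≤ b j := fun j ↦ by positivity
  have hnn : ∀ n, 0 ≤ B.indicator (fun n : ℕ ↦ (n : ℝ)⁻¹) n := fun n ↦
    Set.indicator_nonneg (fun _ _ ↦ by positivity) n
  have hg : Summable fun j : ℕ ↦ A * 2 * Real.log 2 ^ (-s) * ((j + 1 : ℕ) : ℝ) ^ (-s) :=
    ((summable_nat_add_iff 1).mpr (Real.summable_nat_rpow.mpr (by linarith))).mul_left _
  have htend : Tendsto (fun j : ℕ ↦ (2 : ℝ) ^ (j + 1)) atTop atTop :=
    (tendsto_pow_atTop_atTop_of_one_lt one_lt_two).comp (tendsto_add_atTop_nat 1)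
  have hb : Summable b := by
    refine hg.of_norm_bounded_eventually_nat ?_
    filter_upwards [htend.eventually h] with j hj
    rw [Real.norm_eq_abs, abs_of_nonneg (hb0 j), div_le_iff₀ (by positivity)]
    refine hj.trans (le_of_eq ?_)
    rw [Real.log_pow, Real.mul_rpow (by positivity) (Real.log_nonneg one_le_two)]
    ring
  refine summable_of_sum_range_le hnn (c := ∑' j, b j) fun n ↦ ?_
  calc _ ≤ ∑ i ∈ Finset.range (2 ^ n), B.indicator (fun n : ℕ ↦ (n : ℝ)⁻¹) i :=
        Finset.sum_le_sum_of_subset_of_nonneg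
          (Finset.range_mono Nat.lt_two_pow_self.le) fun i _ _ ↦ hnn i
    _ ≤ ∑ j ∈ Finset.range n, b j := sum_range_two_pow_indicator_le n
    _ ≤ _ := hb.sum_le_tsum _ fun j _ ↦ hb0 j

theorem summable_indicator_inv_of_ncard_le {ρ Θ Ψ A : ℝ} (hρ1 : ρ ≤ 1) (hΘ : ρ = 1 → 1 < Θ)
    (h : ∀ x : ℝ, 3 ≤ x → ({p : ℕ | p ∈ B ∧ (p : ℝ) ≤ x}.ncard : ℝ) ≤
      A * (x ^ ρ * Real.log (Real.log x) ^ Ψ / Real.log x ^ Θ)) :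
    Summable (B.indicator fun n : ℕ ↦ (n : ℝ)⁻¹) := by
  obtain ⟨s, hs, hev⟩ : ∃ s : ℝ, 1 < s ∧ ∀ᶠ x : ℝ in atTop,
      x ^ ρ * (Real.log (Real.log x) ^ Ψ / Real.log x ^ Θ) ≤ x * Real.log x ^ (-s) := by
    rcases hρ1.eq_or_lt with rfl | hlt
    · have hΘ1 := hΘ rfl
      -- Midway between 1 and Θ; the other half of Θ - 1 absorbs the power of log log x.
      refine ⟨(Θ + 1) / 2, by linarith, ?_⟩
      filter_upwards [eventually_log_log_rpow_div_le Θ Ψ (τ := (Θ - 1) / 2) (by linarith),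
        eventually_gt_atTop 0] with x hx hx0
      rw [Real.rpow_one, show -((Θ + 1) / 2) = (Θ - 1) / 2 - Θ by ring]
      gcongr
    · refine ⟨2, one_lt_two, ?_⟩
      filter_upwards [eventually_log_log_rpow_div_le Θ Ψ one_pos,
        eventually_log_rpow_le_rpow (1 - Θ + 2) (sub_pos.mpr hlt), eventually_gt_atTop 1]
        with x hx hx2 hx1
      have hx0 : 0 < x := by linarith
      have hlog : 0 < Real.log x := Real.log_pos hx1
      calc x ^ ρ * (Real.log (Real.log x) ^ Ψ / Real.log x ^ Θ)
          ≤ x ^ ρ * Real.log x ^ (1 - Θ) := by gcongr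
        _ = x ^ ρ * (Real.log x ^ (1 - Θ + 2) * Real.log x ^ (-2 : ℝ)) := by
          rw [← Real.rpow_add hlog]; congr 2; ring
        _ ≤ x ^ ρ * (x ^ (1 - ρ) * Real.log x ^ (-2 : ℝ)) := by gcongr
        _ = x * Real.log x ^ (-2 : ℝ) := by
          rw [← mul_assoc, ← Real.rpow_add hx0, add_sub_cancel, Real.rpow_one]
  refine summable_indicator_inv hs (A := |A|) ?_
  filter_upwards [hev, eventually_ge_atTop 3] with x hx hx3
  have hx0 : 0 < x := by linarith
  have hlog : 0 < Real.log x := Real.log_pos (by linarith)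
  have hloglog : 0 ≤ Real.log (Real.log x) := by
    refine Real.log_nonneg ?_
    rw [Real.le_log_iff_exp_le hx0]
    linarith [Real.exp_one_lt_d9]
  calc _ ≤ A * (x ^ ρ * Real.log (Real.log x) ^ Ψ / Real.log x ^ Θ) := h x hx3
    _ ≤ |A| * (x ^ ρ * (Real.log (Real.log x) ^ Ψ / Real.log x ^ Θ)) := by
        rw [mul_div_assoc]
        gcongr
        exact le_abs_self A
    _ ≤ _ := by gcongr

/-- `B`-free numbers have positive density in short intervals. -/
theorem exists_ncard_free_ge (hB : ∀ p ∈ B, p.Prime) {ρ Θ Ψ A ε : ℝ} (hρ0 : 0 ≤ ρ) (hρ1 : ρ ≤ 1)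
    (hΘ : ρ = 1 → 1 < Θ)
    (h : ∀ x : ℝ, 3 ≤ x → ({p : ℕ | p ∈ B ∧ (p : ℝ) ≤ x}.ncard : ℝ) ≤
      A * (x ^ ρ * Real.log (Real.log x) ^ Ψ / Real.log x ^ Θ)) (hε : 0 < ε) :
    ∃ c > 0, ∃ x₀ : ℝ, 1 ≤ x₀ ∧ ∀ x y, x₀ ≤ x → x ^ (ρ / (1 + ρ) + ε) ≤ y →
      c * y ≤ ({n : ℕ | x < n ∧ n ≤ x + y ∧ ∀ p ∈ B, ¬ p ∣ n}.ncard : ℝ) := by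
  classical
  -- With θ ≤ 1/2 this keeps θ + ε' ≤ 3/4, as used below for long intervals.
  set ε' := min ε (1 / 4)
  have hε' : 0 < ε' := lt_min hε (by norm_num)
  have hε'4 : ε' ≤ 1 / 4 := min_le_right _ _
  obtain ⟨A', hA'⟩ := exists_ncard_le_rpow (fun p hp ↦ (hB p hp).ne_zero) hρ0 h
    (show 0 < ε' / 2 by positivity)
  obtain ⟨c, hc, hev⟩ := exists_card_free_ge_of_le hB
    (summable_indicator_inv_of_ncard_le hρ1 hΘ h) hρ0 hρ1 hε' hε'4 hA'
  obtain ⟨x₁, hx₁⟩ := hev.exists_forall_of_atTop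
  set θ := ρ / (1 + ρ) with hθ
  have hθ0 : 0 ≤ θ := by positivity
  have hθ1 : θ ≤ 1 / 2 := by rw [hθ, div_le_iff₀ (by linarith)]; linarith
  have hset (x y : ℝ) (hx : 0 ≤ x) (hy : 0 ≤ y) :
      {n : ℕ | x < n ∧ n ≤ x + y ∧ ∀ p ∈ B, ¬ p ∣ n} =
        ((Finset.Ioc ⌊x⌋₊ ⌊x + y⌋₊).filter (fun n ↦ ∀ p ∈ B, ¬ p ∣ n) : Finset ℕ) := by
    ext n
    rw [Finset.mem_coe, Finset.mem_filter, Finset.mem_Ioc, Nat.floor_lt hx,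
      Nat.le_floor_iff (by positivity), and_assoc]
    rfl
  refine ⟨c / 2, by positivity, max x₁ 54, by simp, fun x y hx hy ↦ ?_⟩
  have hxx₁ := (le_max_left _ _).trans hx
  have hx54 := (le_max_right _ _).trans hx
  have hx0 : 0 < x := by linarith
  have hy' : x ^ (θ + ε') ≤ y :=
    (Real.rpow_le_rpow_of_exponent_le (by linarith) (by linarith [min_le_left ε (1 / 4)])).trans hy
  have hy0 : 0 ≤ y := le_trans (by positivity) hy
  rcases le_total y x with hyx | hyx
  · rw [hset x y hx0.le hy0, Set.ncard_coe_finset]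
    refine le_trans ?_ (hx₁ x hxx₁ y hy' hyx)
    gcongr
    linarith
  -- When y ≥ x, the upper half (x + y/2, x + y] starts at a point at least as large as its length.
  -- It is long enough because x + y/2 ≤ 3(y/2) and (3z)^(3/4) ≤ z for z ≥ 27, whence the threshold
  -- 54.
  · have hz : (27 : ℝ) ≤ y / 2 := by linarith
    have h1 : (x + y / 2) ^ (θ + ε') ≤ y / 2 := by
      have hz0 : 0 < y / 2 := by linarith
      calc (x + y / 2) ^ (θ + ε') ≤ (3 * (y / 2)) ^ (θ + ε') := by
            gcongr; linarith
        _ ≤ (3 * (y / 2)) ^ (3 / 4 : ℝ) :=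
            Real.rpow_le_rpow_of_exponent_le (by linarith) (by linarith)
        _ = (27 * (y / 2) ^ 3) ^ (1 / 4 : ℝ) := by
            rw [show (27 : ℝ) * (y / 2) ^ 3 = (3 * (y / 2)) ^ (3 : ℝ) by
              rw [show (3 : ℝ) = (3 : ℕ) by norm_num, Real.rpow_natCast]; push_cast; ring,
              ← Real.rpow_mul (by positivity)]
            norm_num
        _ ≤ ((y / 2) ^ 4) ^ (1 / 4 : ℝ) := by
            gcongr
            have : 0 ≤ (y / 2) ^ 3 := by positivity
            nlinarith
        _ = y / 2 := by
            rw [← Real.rpow_natCast, ← Real.rpow_mul hz0.le]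
            norm_num
    have h2 := hx₁ (x + y / 2) (by linarith) (y / 2) h1 (by linarith)
    rw [← Set.ncard_coe_finset, ← hset _ _ (by linarith) (by linarith)] at h2
    have h3 : {n : ℕ | x + y / 2 < n ∧ n ≤ x + y / 2 + y / 2 ∧ ∀ p ∈ B, ¬ p ∣ n} ⊆
        {n : ℕ | x < n ∧ n ≤ x + y ∧ ∀ p ∈ B, ¬ p ∣ n} := fun n hn ↦
      ⟨by linarith [hn.1], by linarith [hn.2.1], hn.2.2⟩
    have h4 := Set.ncard_le_ncard h3 (by rw [hset x y hx0.le hy0]; exact Finset.finite_toSet _)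
    have h5 : (({n : ℕ | x + y / 2 < n ∧ n ≤ x + y / 2 + y / 2 ∧ ∀ p ∈ B, ¬ p ∣ n}.ncard : ℕ) : ℝ) ≤
        ({n : ℕ | x < n ∧ n ≤ x + y ∧ ∀ p ∈ B, ¬ p ∣ n}.ncard : ℝ) := by exact_mod_cast h4
    linarith

end KRW

end

/-! ### Application to the coefficients and uniformity in the exponents -/

namespace KRW

variable {N : ℕ} {k : ℤ}

theorem prime_of_mem_badPrimes {f : CuspFormGamma1 N k} {p : ℕ} (hp : p ∈ badPrimes f) :
    p.Prime := by
  rcases hp with h | h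
  · exact h.1
  · obtain ⟨ν, -, h⟩ := Set.mem_iUnion₂.mp h
    exact h.1

theorem exists_ncard_coeff_ne_zero_ge {χ : DirichletCharacter ℂ N} {f : CuspFormGamma1 N k}
    (hf : IsPrimitive χ f) {ρ Θ Ψ ε : ℝ} (hρ0 : 0 ≤ ρ) (hρ1 : ρ ≤ 1) (hΘ : ρ = 1 → 1 < Θ)
    (h : BadPrimesBound f ρ Θ Ψ) (hε : 0 < ε) :
    ∃ c > 0, ∃ x₀ : ℝ, 1 ≤ x₀ ∧ ∀ x y, x₀ ≤ x → x ^ (ρ / (1 + ρ) + ε) ≤ y →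
      c * y ≤ ({n : ℕ | x < n ∧ (n : ℝ) ≤ x + y ∧ coeff f n ≠ 0}.ncard : ℝ) := by
  obtain ⟨A, hA⟩ := h
  obtain ⟨c, hc, x₀, hx₀, H⟩ :=
    exists_ncard_free_ge (fun p hp ↦ prime_of_mem_badPrimes hp) hρ0 hρ1 hΘ hA hε
  refine ⟨c, hc, x₀, hx₀, fun x y hx hy ↦ (H x y hx hy).trans ?_⟩
  refine Nat.cast_le.mpr (Set.ncard_le_ncard (fun n hn ↦ ⟨hn.1, hn.2.1, ?_⟩)
    ((Set.finite_Iic ⌊x + y⌋₊).subset fun n hn ↦ Nat.le_floor hn.2.1))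
  refine coeff_ne_zero_of_forall_badPrimes hf n ?_ hn.2.2
  rintro rfl
  have := hn.1
  simp only [Nat.cast_zero] at this
  linarith

/-- Short intervals containing nonzero coefficients bound the runs of zeros. -/
theorem exists_zeroRuns_le (f : CuspFormGamma1 N k) {c x₀ e : ℝ} (hc : 0 < c) (hx₀ : 1 ≤ x₀)
    (he : 0 ≤ e)
    (h : ∀ x y, x₀ ≤ x → x ^ e ≤ y →
      c * y ≤ ({n : ℕ | x < n ∧ (n : ℝ) ≤ x + y ∧ coeff f n ≠ 0}.ncard : ℝ)) :
    ∃ C : ℝ, ∀ n : ℕ, 1 ≤ n → ∀ m ∈ zeroRuns f n, (m : ℝ) ≤ C * (n : ℝ) ^ e := by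
  set n₀ := ⌈x₀⌉₊
  -- The first n₀ terms of the run are dropped so that the interval starts beyond x₀; the factor (1
  -- + n₀)^e comes from n + n₀ ≤ (1 + n₀)n.
  refine ⟨n₀ + (1 + n₀) ^ e, fun n hn m hm ↦ ?_⟩
  have hn1 : (1 : ℝ) ≤ n := by exact_mod_cast hn
  have hne : 1 ≤ (n : ℝ) ^ e := Real.one_le_rpow hn1 he
  have hx₀n : x₀ ≤ ((n + n₀ : ℕ) : ℝ) := by
    push_cast
    linarith [Nat.le_ceil x₀]
  have h1 : ((n + n₀ : ℕ) : ℝ) ^ e ≤ (1 + n₀) ^ e * (n : ℝ) ^ e := by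
    rw [← Real.mul_rpow (by positivity) (by positivity)]
    refine Real.rpow_le_rpow (by positivity) ?_ he
    push_cast
    nlinarith [(Nat.cast_nonneg n₀ : (0 : ℝ) ≤ n₀)]
  by_contra! hlt
  have h2 : (n₀ : ℝ) ≤ n₀ * (n : ℝ) ^ e := le_mul_of_one_le_right (Nat.cast_nonneg _) hne
  have hy : ((n + n₀ : ℕ) : ℝ) ^ e ≤ m - n₀ := by linarith
  have hy0 : (0 : ℝ) < m - n₀ := lt_of_lt_of_le (Real.rpow_pos_of_pos (by linarith) e) hy
  have h3 := h _ _ hx₀n hy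
  have h4 : {j : ℕ | ((n + n₀ : ℕ) : ℝ) < j ∧ (j : ℝ) ≤ ((n + n₀ : ℕ) : ℝ) + (m - n₀) ∧
      coeff f j ≠ 0} = ∅ := by
    refine Set.eq_empty_of_forall_notMem fun j ⟨hj1, hj2, hj3⟩ ↦ hj3 ?_
    have hj1' : n + n₀ < j := by exact_mod_cast hj1
    have hj2' : j ≤ n + m := by
      have : (j : ℝ) ≤ n + m := by push_cast at hj2; linarith
      exact_mod_cast this
    obtain ⟨i, rfl⟩ : ∃ i, j = n + i := ⟨j - n, by omega⟩
    exact hm.2 i (by omega) (by omega)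
  rw [h4, Set.ncard_empty, Nat.cast_zero] at h3
  nlinarith

/-- The map t ↦ t/(1 + t) is increasing and 1-Lipschitz on t ≥ 0. -/
theorem div_one_add_le_add {a b : ℝ} (ha : 0 ≤ a) (hb : 0 ≤ b) {δ : ℝ} (hδ : 0 ≤ δ)
    (h : a ≤ b + δ) : a / (1 + a) ≤ b / (1 + b) + δ := by
  rw [div_add' _ _ _ (by positivity), div_le_div_iff₀ (by positivity) (by positivity)]
  nlinarith [mul_nonneg ha hb, mul_nonneg hδ ha, mul_nonneg hδ hb,
    mul_nonneg (mul_nonneg hδ ha) hb]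

end KRW

/-- The constants `x₀`, `c`, `C` depend only on `f` and `ε`. -/
theorem theorem2 (N : ℕ) [NeZero N] (k : ℤ) (hk : 2 ≤ k) (χ : DirichletCharacter ℂ N)
    (f : KRW.CuspFormGamma1 N k) (hf : KRW.IsPrimitive χ f) (hCM : ¬ KRW.IsCM f)
    (ε : ℝ) (hε : 0 < ε) :
    ∃ x₀ c C : ℝ, 0 < c ∧
      ∀ ρ Θ Ψ : ℝ, 0 ≤ ρ → ρ ≤ 1 → (ρ = 1 → 1 < Θ) → KRW.BadPrimesBound f ρ Θ Ψ →
        (∀ x y : ℝ, x₀ ≤ x → x ^ (ρ / (1 + ρ) + ε) ≤ y →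
          c * y ≤ ({n : ℕ | x < n ∧ (n : ℝ) ≤ x + y ∧ KRW.coeff f n ≠ 0}.ncard : ℝ)) ∧
        (∀ n : ℕ, 1 ≤ n → BddAbove (KRW.zeroRuns f n) ∧
          (KRW.gap f n : ℝ) ≤ C * (n : ℝ) ^ (ρ / (1 + ρ) + ε)) := by
  -- The constants must precede ρ, Θ, Ψ, so they are taken from a single admissible ρ' within ε/2 of
  -- the infimum, which need not be attained. Using ε/2 for ρ' leaves room to cover every admissible
  -- ρ with ε.
  set Adm : Set ℝ := {ρ | 0 ≤ ρ ∧ ρ ≤ 1 ∧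
    ∃ Θ Ψ : ℝ, (ρ = 1 → 1 < Θ) ∧ KRW.BadPrimesBound f ρ Θ Ψ}
  rcases Adm.eq_empty_or_nonempty with hempty | hne
  · refine ⟨0, 1, 0, one_pos, fun ρ Θ Ψ h0 h1 hΘ hbound ↦ ?_⟩
    have : ρ ∈ Adm := ⟨h0, h1, Θ, Ψ, hΘ, hbound⟩
    rw [hempty] at this
    exact this.elim
  have hbdd : BddBelow Adm := ⟨0, fun ρ hρ ↦ hρ.1⟩
  obtain ⟨ρ', ⟨hρ0', hρ1', Θ', Ψ', hΘ', hbound'⟩, hρ'⟩ :=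
    exists_lt_of_csInf_lt hne (lt_add_of_pos_right (sInf Adm) (half_pos hε))
  have he : ∀ ρ ∈ Adm, ρ' / (1 + ρ') + ε / 2 ≤ ρ / (1 + ρ) + ε := fun ρ hρ ↦ by
    have := KRW.div_one_add_le_add hρ0' hρ.1 (half_pos hε).le
      (hρ'.le.trans (by linarith [csInf_le hbdd hρ]))
    linarith
  obtain ⟨c, hc, x₀, hx₀, H⟩ :=
    KRW.exists_ncard_coeff_ne_zero_ge hf hρ0' hρ1' hΘ' hbound' (half_pos hε)
  obtain ⟨C, hC⟩ := KRW.exists_zeroRuns_le f hc hx₀ (by positivity) H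
  refine ⟨x₀, c, max C 0, hc, fun ρ Θ Ψ h0 h1 hΘ hbound ↦ ⟨fun x y hx hy ↦ ?_, fun n hn ↦ ?_⟩⟩
  · have hρ := he ρ ⟨h0, h1, Θ, Ψ, hΘ, hbound⟩
    exact H x y hx ((Real.rpow_le_rpow_of_exponent_le (hx₀.trans hx) hρ).trans hy)
  · have hρ := he ρ ⟨h0, h1, Θ, Ψ, hΘ, hbound⟩
    have hn1 : (1 : ℝ) ≤ n := by exact_mod_cast hn
    have hle : C * (n : ℝ) ^ (ρ' / (1 + ρ') + ε / 2) ≤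
        max C 0 * (n : ℝ) ^ (ρ / (1 + ρ) + ε) := by
      gcongr
      · exact le_max_left _ _
    have hbound : BddAbove (KRW.zeroRuns f n) :=
      ⟨⌊C * (n : ℝ) ^ (ρ' / (1 + ρ') + ε / 2)⌋₊, fun m hm ↦ Nat.le_floor (hC n hn m hm)⟩
    refine ⟨hbound, ?_⟩
    rcases (KRW.zeroRuns f n).eq_empty_or_nonempty with h | h
    -- Without zero runs the supremum is 0, so the bound needs a nonnegative constant, hence `max C
    -- 0`.
    · rw [KRW.gap, h, csSup_empty]
      simp only [bot_eq_zero', Nat.cast_zero]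
      positivity
    · exact (hC n hn _ (Nat.sSup_mem h hbound)).trans hle
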